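/- **Setting.** Let $V$ be a finite vertex set. A *PDAG* on $V$ is a simple graph (no self-loops, at most one edge of any type between two vertices) with directed edges $a\to b$ and undirected edges $a-b$ and without directed cycles; a *DAG* is a PDAG without undirected edges. The *skeleton* is obtained by forgetting directions. A *v-structure* is $a\to b\leftarrow c$ with $a\ne c$ not adjacent. A PDAG $\mathcal G$ is an *MPDAG* if (i) for each connected component $C$ of its undirected part, the skeleton of the induced graph $\mathcal G_C$ is chordal, and (ii) none of the following occurs as an induced subgraph: $a\to b-c$ with $a,c$ not adjacent; $a\to b\to c$ with $a-c$; $a-b,\ a-c,\ a-d,\ b\to d\leftarrow c$ with $b\neq c$ not adjacent; $a-b,\ a-c,\ a-d,\ b\to d\to c$ with $b,c$ not adjacent. A DAG is *represented by* $\mathcal G$ if it arises by orienting all undirected edges of $\mathcal G$ without introducing a directed cycle or a v-structure. The *pseudo-rank* of $\mathcal G$ is the number of its directed edges plus twice the number of its undirected edges. For each $v\in V$ let $\mathcal X_v$ be a measurable space with at least two elements in which singletons are measurable; $\mathcal X_I=\prod_{v\in I}\mathcal X_v$ for $I\subseteq V$. Let $\mathcal M^{c}$ be the set of laws $P$ (probability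 measures for the product $\sigma$-algebra) of potential outcome schedules $(X_v(x_I): v\in V,\ I\subseteq V,\ x_I\in\mathcal X_I)$ that are consistent: $P\big(X(x_I,x_{I'})=X(x_I)\mid X_{I'}(x_I)=x_{I'}\big)=1$ for all disjoint $I,I'\subseteq V$ and all $x\in\mathcal X_V$ (nothing is required if the conditioning event has probability zero). For a DAG $\mathcal D$, let $\mathcal M(\mathcal D)$ be the set of $P\in\mathcal M^{c}$ such that $X_v(x_I)=X_v(x_{I\cap \mathrm{Pa}_{\mathcal D}(v)})$ almost surely for all $v,I,x$, and, for every $x$, the variables $X_v(x_{\mathrm{Pa}_{\mathcal D}(v)})$, $v\in V$, are mutually independent. For an MPDAG $\mathcal G$, let $\mathcal M(\mathcal G)$ be the union of $\mathcal M(\mathcal D)$ over the DAGs $\mathcal D$ represented by $\mathcal G$. Order the MPDAGs on $V$ by $\mathcal G_1\preceq\mathcal G_2$ iff $\mathcal M(\mathcal G_1)\subseteq\mathcal M(\mathcal G_2)$; write $\mathcal G_1\prec\mathcal G_2$ if moreover $\mathcal G_1\neq\mathcal G_2$, and $\mathcal G_1\lessdot\mathcal G_2$ ($\mathcal G_2$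 *covers* $\mathcal G_1$) if $\mathcal G_1\prec\mathcal G_2$ and there is no MPDAG $\mathcal H$ with $\mathcal G_1\prec\mathcal H\prec\mathcal G_2$. **Proposition.** Let $\mathcal G$ be an MPDAG on $V$, with $u$ undirected edges and pseudo-rank $k$. Then there are MPDAGs $$\mathcal G=x_0\gtrdot x_1\gtrdot\cdots\gtrdot x_k$$ on $V$, where $x_k$ is the empty MPDAG (no edges). Moreover the chain can be chosen such that for $i<u$ the graph $x_{i+1}$ is $x_i$ with one undirected edge $a-b$ replaced by $a\to b$ and nothing else changed, and for $u\le i<k$ the graph $x_{i+1}$ is $x_i$ with one directed edge deleted. -/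

import Mathlib

open MeasureTheory ProbabilityTheory

namespace CausalGraph

/-- A partially directed acyclic graph on the vertex set `V`: a simple graph with directed edges
`a → b` (`dir a b`) and undirected edges `a - b` (`und.Adj a b`), at most one edge (of any type)
between two vertices, no self-loops and no directed cycle.
Irreflexivity and asymmetry of `dir` are part of `acyclic`. -/
@[ext]
structure PDAG (V : Type*) where
  dir : V → V → Prop
  und : SimpleGraph V
  not_both : ∀ a b, dir a b → ¬ und.Adj a b
  acyclic : ∀ v, ¬ Relation.TransGen dir v v

/-- A graph is chordal if every cycle of length at least four has a chord, i.e. an edge joining two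
vertices of the cycle that are not consecutive on it. -/
def Chordal {W : Type*} (H : SimpleGraph W) : Prop :=
  ∀ (v : W) (c : H.Walk v v), c.IsCycle → 4 ≤ c.length →
    ∃ a ∈ c.support, ∃ b ∈ c.support, H.Adj a b ∧ s(a, b) ∉ c.edges

namespace PDAG

variable {V : Type*}

/-- The skeleton: forget the directions of the edges. -/
def skeleton (G : PDAG V) : SimpleGraph V where
  Adj a b := G.dir a b ∨ G.dir b a ∨ G.und.Adj a b
  symm := ⟨fun a b h => by
    rcases h with h | h | h
    · exact Or.inr (Or.inl h)
    · exact Or.inl h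
    · exact Or.inr (Or.inr h.symm)⟩
  loopless := ⟨fun a h => by
    rcases h with h | h | h
    · exact G.acyclic a (Relation.TransGen.single h)
    · exact G.acyclic a (Relation.TransGen.single h)
    · exact G.und.loopless.irrefl a h⟩

/-- The graph without edges. -/
def empty (V : Type*) : PDAG V where
  dir _ _ := False
  und := ⊥
  not_both _ _ h := h.elim
  acyclic v h := by
    have key : ∀ w, Relation.TransGen (fun _ _ : V => False) v w → False := by
      intro w hw
      cases hw with
      | single h => exact h
      | tail _ h => exact h
    exact key v h

/-- A DAG is a PDAG all of whose edges are directed. -/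
def IsDAG (G : PDAG V) : Prop := G.und = ⊥

/-- The parents of a vertex. -/
def parents (G : PDAG V) (v : V) : Set V := {u | G.dir u v}

/-- A v-structure `a → b ← c`, with `a` and `c` distinct and not adjacent. -/
def IsVStructure (G : PDAG V) (a b c : V) : Prop :=
  G.dir a b ∧ G.dir c b ∧ a ≠ c ∧ ¬ G.skeleton.Adj a c

/-- `G.Represents D`: `D` is a DAG obtained by orienting all undirected edges of `G` (so it has the
same skeleton and keeps the directed edges of `G`), without introducing a v-structure
(or a directed cycle, `D` being a PDAG). -/
def Represents (G D : PDAG V) : Prop :=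
  D.IsDAG ∧ D.skeleton = G.skeleton ∧ (∀ a b, G.dir a b → D.dir a b) ∧
    ∀ a b c, D.IsVStructure a b c → G.IsVStructure a b c

/-- `a → b - c` as an induced subgraph. -/
def Forbidden₁ (G : PDAG V) (a b c : V) : Prop :=
  G.dir a b ∧ G.und.Adj b c ∧ ¬ G.skeleton.Adj a c

/-- `a → b → c` together with `a - c`. -/
def Forbidden₂ (G : PDAG V) (a b c : V) : Prop :=
  G.dir a b ∧ G.dir b c ∧ G.und.Adj a c

/-- `a - b`, `a - c`, `a - d`, `b → d ← c`, with `b` and `c` distinct and not adjacent. -/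
def Forbidden₃ (G : PDAG V) (a b c d : V) : Prop :=
  G.und.Adj a b ∧ G.und.Adj a c ∧ G.und.Adj a d ∧ G.dir b d ∧ G.dir c d ∧
    b ≠ c ∧ ¬ G.skeleton.Adj b c

/-- `a - b`, `a - c`, `a - d`, `b → d → c`, with `b` and `c` not adjacent. -/
def Forbidden₄ (G : PDAG V) (a b c d : V) : Prop :=
  G.und.Adj a b ∧ G.und.Adj a c ∧ G.und.Adj a d ∧ G.dir b d ∧ G.dir d c ∧
    ¬ G.skeleton.Adj b c

/-- A PDAG is an MPDAG if for every connected component `C` of its undirected part the skeleton of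
the induced graph on `C` is chordal, and none of the four forbidden structures is an induced
subgraph. -/
def IsMPDAG (G : PDAG V) : Prop :=
  (∀ C : G.und.ConnectedComponent, Chordal (G.skeleton.induce C.supp)) ∧
  (∀ a b c, ¬ G.Forbidden₁ a b c) ∧ (∀ a b c, ¬ G.Forbidden₂ a b c) ∧
  (∀ a b c d, ¬ G.Forbidden₃ a b c d) ∧ (∀ a b c d, ¬ G.Forbidden₄ a b c d)

/-- The number of directed edges. -/
noncomputable def numDirected (G : PDAG V) : ℕ := {e : V × V | G.dir e.1 e.2}.ncard

/-- The number of undirected edges. -/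
noncomputable def numUndirected (G : PDAG V) : ℕ := G.und.edgeSet.ncard

/-- Number of directed edges plus twice the number of undirected edges. -/
noncomputable def pseudoRank (G : PDAG V) : ℕ := G.numDirected + 2 * G.numUndirected

/-- `H` is `G` with one undirected edge `a - b` replaced by the directed edge `a → b`. -/
def OrientsOneEdge (G H : PDAG V) : Prop :=
  ∃ a b, G.und.Adj a b ∧ H.und = G.und.deleteEdges {s(a, b)} ∧
    ∀ u v, H.dir u v ↔ G.dir u v ∨ (u = a ∧ v = b)

/-- `H` is `G` with one directed edge `a → b` removed. -/
def DeletesOneDirectedEdge (G H : PDAG V) : Prop :=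
  ∃ a b, G.dir a b ∧ H.und = G.und ∧ ∀ u v, H.dir u v ↔ G.dir u v ∧ ¬ (u = a ∧ v = b)

end PDAG

/-- The MPDAGs over the vertex set `V`. -/
def MPDAG (V : Type*) : Type _ := {G : PDAG V // G.IsMPDAG}

/-- The empty MPDAG. -/
def MPDAG.empty (V : Type*) : MPDAG V :=
  ⟨PDAG.empty V, by
    refine ⟨fun C v c hc _ => ?_, fun a b c h => h.1, fun a b c h => h.1,
      fun a b c d h => h.2.2.2.1, fun a b c d h => h.2.2.2.1⟩
    cases c with
    | nil => exact absurd rfl hc.ne_nil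
    | cons h p =>
      have h' : (PDAG.empty V).skeleton.Adj _ _ := h
      rcases h' with h' | h' | h'
      · exact h'.elim
      · exact h'.elim
      · exact (h' : False).elim⟩

section Models

variable {V : Type*} (X : V → Type*)

/-- The space of potential outcome schedules `(X_v(x_I) : v ∈ V, I ⊆ V, x_I ∈ 𝒳_I)`.
As an iterated product it carries the product σ-algebra. -/
abbrev Schedule : Type _ := (v : V) → (I : Set V) → ((i : I) → X i) → X v

variable {X}

/-- The potential outcome `X_v(x_I)` of the vertex `v`, when `I` is set to the values that the
assignment `x` gives to it. -/
def Schedule.outcome (ω : Schedule X) (v : V) (I : Set V) (x : (v : V) → X v) : X v :=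
  ω v I (fun i => x i)

variable (X) [∀ v, MeasurableSpace (X v)]

/-- The ground causal model: the laws of the potential outcome schedule that satisfy consistency,
`P (X(x_I, x_I') = X(x_I) | X_I'(x_I) = x_I') = 1` for all disjoint `I`, `I'` and all `x` (no
condition when the event conditioned on has probability zero). -/
def groundModel : Set (Measure (Schedule X)) :=
  {P | IsProbabilityMeasure P ∧
    ∀ (I I' : Set V) (x : (v : V) → X v), Disjoint I I' →
      ∀ᵐ ω ∂P, (∀ i ∈ I', ω.outcome i I x = x i) →
        ∀ v, ω.outcome v (I ∪ I') x = ω.outcome v I x}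

/-- The causal model of a DAG `D`: the laws in the ground model that are causal Markov, i.e.
`X_v(x_I) = X_v(x_{I ∩ Pa(v)})` almost surely for all `v`, `I`, `x`, and for every `x` the
one-step-ahead counterfactuals `X_v(x_{Pa(v)})`, `v ∈ V`, are mutually independent. -/
def dagModel (D : PDAG V) : Set (Measure (Schedule X)) :=
  {P | P ∈ groundModel X ∧
    (∀ (v : V) (I : Set V) (x : (v : V) → X v),
      ∀ᵐ ω ∂P, ω.outcome v I x = ω.outcome v (I ∩ D.parents v) x) ∧
    ∀ x : (v : V) → X v,
      iIndepFun (fun (v : V) (ω : Schedule X) => ω.outcome v (D.parents v) x) P}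

/-- The causal model of an MPDAG: the union of the models of the DAGs it represents. -/
def mpdagModel (G : MPDAG V) : Set (Measure (Schedule X)) :=
  {P | ∃ D : PDAG V, G.1.Represents D ∧ P ∈ dagModel X D}

/-- The model-oriented order: `G₁ ⪯ G₂` if the model of `G₁` is contained in that of `G₂`. -/
def ModelLE (G₁ G₂ : MPDAG V) : Prop := mpdagModel X G₁ ⊆ mpdagModel X G₂

/-- The strict order `G₁ ≺ G₂`. -/
def ModelLT (G₁ G₂ : MPDAG V) : Prop := ModelLE X G₁ G₂ ∧ G₁ ≠ G₂

/-- `G₂` covers `G₁`, written `G₁ ⋖ G₂`. -/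
def CoveredBy (G₁ G₂ : MPDAG V) : Prop :=
  ModelLT X G₁ G₂ ∧ ¬ ∃ H : MPDAG V, ModelLT X G₁ H ∧ ModelLT X H G₂

end Models

end CausalGraph

namespace CausalGraph

/-! The pseudo-rank drops by one both when an undirected edge becomes directed and when a directed
edge is deleted. So it suffices to find one such step out of every nonempty MPDAG and to show that
it is a cover; the chain follows by induction.

Existence of an orientation: a directed version of Dirac's theorem on simplicial vertices
(`ChordalOn.exists_sink`) gives, in each nontrivial undirected component, a vertex `x` with no
outgoing edge inside the component and with pairwise adjacent neighbours there. Orienting into `x`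
the edge from a minimal undirected neighbour creates no forbidden subgraph. Since `x` can be chosen
different from any prescribed `a`, repetition produces a represented DAG containing `a → b` for each
undirected `a - b`. Hence the directed edges of an MPDAG are exactly those common to all its DAGs.

Covering: each DAG `D` has a law lying only in models of DAGs that contain all edges of `D`
(`exists_faithful`). The order thereby becomes graphical (`modelLE_iff`): every DAG of the smaller
graph is contained in one of the larger. A graph between the two ends of a step then has its
directed edges squeezed between two sets that differ by a single edge. -/

/-- Chordality of the subgraph induced on `C`, expressed through cycles of the ambient graph. -/
def ChordalOn {V : Type*} (H : SimpleGraph V) (C : Set V) : Prop :=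
  ∀ (v : V) (c : H.Walk v v), c.IsCycle → (∀ x ∈ c.support, x ∈ C) → 4 ≤ c.length →
    ∃ a ∈ c.support, ∃ b ∈ c.support, H.Adj a b ∧ s(a, b) ∉ c.edges

/-! ### Chordal graphs and simplicial sinks. -/

section Chordal

variable {V : Type*} {H : SimpleGraph V}

theorem ChordalOn.mono {C C' : Set V} (h : ChordalOn H C) (hC : C' ⊆ C) : ChordalOn H C' :=
  fun v c hc hs hl => h v c hc (fun x hx => hC (hs x hx)) hl

/-- Cycles transfer in both directions along the injective inclusion of the induced subgraph. The
ambient form makes it possible to shrink `C` without changing the vertex type. -/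
theorem chordal_induce_iff (C : Set V) : Chordal (H.induce C) ↔ ChordalOn H C := by
  have hinj : Function.Injective (SimpleGraph.Embedding.induce (G := H) C).toHom :=
    (SimpleGraph.Embedding.induce (G := H) C).injective
  constructor
  · intro h v c hc hs hl
    have hmap := c.map_induce hs
    obtain ⟨a, ha, b, hb, hab, he⟩ := h _ (c.induce C hs)
      ((SimpleGraph.Walk.isCycle_map_iff_of_injective hinj).1 (by rw [hmap]; exact hc))
      (by rw [← SimpleGraph.Walk.length_map (SimpleGraph.Embedding.induce C).toHom, hmap]; exact hl)
    have key : c.edges = ((c.induce C hs).edges).map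
        (Sym2.map (SimpleGraph.Embedding.induce (G := H) C).toHom) := by
      rw [← SimpleGraph.Walk.edges_map, hmap]
      rfl
    rw [SimpleGraph.Walk.support_induce] at ha hb
    refine ⟨a, by simpa using ha, b, by simpa using hb, hab, fun hmem => he ?_⟩
    rw [key, List.mem_map] at hmem
    obtain ⟨e, he', heq⟩ := hmem
    have : e = s(a, b) := Sym2.map.injective hinj (by rw [heq]; rfl)
    exact this ▸ he'
  · intro h v c hc hl
    obtain ⟨a, ha, b, hb, hab, he⟩ := h _ (c.map (SimpleGraph.Embedding.induce (G := H) C).toHom)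
      (hc.map hinj) (by
        intro x hx
        rw [SimpleGraph.Walk.support_map, List.mem_map] at hx
        obtain ⟨y, -, rfl⟩ := hx
        exact y.2) (by rw [SimpleGraph.Walk.length_map]; exact hl)
    rw [SimpleGraph.Walk.support_map, List.mem_map] at ha hb
    obtain ⟨a, ha, rfl⟩ := ha
    obtain ⟨b, hb, rfl⟩ := hb
    refine ⟨a, ha, b, hb, hab, fun hmem => he ?_⟩
    rw [SimpleGraph.Walk.edges_map]
    exact List.mem_map_of_mem (f := Sym2.map (SimpleGraph.Embedding.induce (G := H) C).toHom) hmem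

/-- In a chordal graph, two neighbours of `u` that are joined by a walk whose interior avoids the
closed neighbourhood of `u` are adjacent. -/
theorem ChordalOn.adj_of_walk {C : Set V} (h : ChordalOn H C) {u s t : V} (hu : u ∈ C)
    (hus : H.Adj u s) (hut : H.Adj u t) (hst : s ≠ t) (p : H.Walk s t)
    (hp : ∀ y ∈ p.support, y ∈ C ∧ y ≠ u ∧ (y = s ∨ y = t ∨ ¬ H.Adj u y)) : H.Adj s t := by
  classical
  induction hn : p.length using Nat.strong_induction_on generalizing p with
  | _ n ih =>
  by_cases hpath : p.IsPath
  swap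
  · refine ih p.bypass.length ?_ p.bypass
      (fun y hy => hp y (p.support_bypass_subset_support hy)) rfl
    rw [← hn]
    refine lt_of_le_of_ne p.length_bypass_le_length fun heq => hpath ?_
    rw [← p.bypass_eq_self_of_length_le_length_bypass heq.ge]
    exact p.bypass_isPath
  by_contra hadj
  have hlen : 2 ≤ p.length := by
    by_contra hlt
    have : p.length = 0 ∨ p.length = 1 := by omega
    rcases this with h0 | h1
    · exact hst (SimpleGraph.Walk.eq_of_length_eq_zero h0)
    · exact hadj (SimpleGraph.Walk.adj_of_length_eq_one h1)
  have hup : u ∉ p.support := fun hmem => (hp u hmem).2.1 rfl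
  -- If `s` and `t` are not adjacent, closing the path through `u` gives a cycle of length at least
  -- four. No chord can end at `u`, so a chord joins two vertices of the path and shortcuts it,
  -- against the induction on length.
  set c : H.Walk u u := SimpleGraph.Walk.cons hus (p.concat hut.symm) with hc
  have hcsupp : ∀ y, y ∈ c.support ↔ y = u ∨ y ∈ p.support := by
    intro y
    simp [hc, SimpleGraph.Walk.support_concat]
    tauto
  have hcedge : ∀ e, e ∈ c.edges ↔ e = s(u, s) ∨ e ∈ p.edges ∨ e = s(t, u) := by
    intro e
    simp [hc, SimpleGraph.Walk.edges_concat]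
  have hcyc : c.IsCycle := by
    rw [hc, SimpleGraph.Walk.cons_isCycle_iff]
    refine ⟨SimpleGraph.Walk.IsPath.concat hpath hup _, ?_⟩
    rw [SimpleGraph.Walk.edges_concat]
    simp only [List.concat_eq_append, List.mem_append, List.mem_singleton, not_or]
    refine ⟨fun hmem => hup (p.fst_mem_support_of_mem_edges hmem), ?_⟩
    intro heq
    rw [Sym2.eq_iff] at heq
    rcases heq with ⟨h1, h2⟩ | ⟨-, h2⟩
    · exact hus.ne h2.symm
    · exact hst h2
  obtain ⟨a, ha, b, hb, hab, he⟩ := h u c hcyc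
    (fun x hx => ((hcsupp x).1 hx).elim (fun h => h ▸ hu) fun h => (hp x h).1)
    (by simp [hc]; omega)
  rw [hcsupp] at ha hb
  rw [hcedge] at he
  push Not at he
  have huadj : ∀ y, y ∈ p.support → H.Adj u y → s(u, y) = s(u, s) ∨ s(u, y) = s(t, u) := by
    intro y hy huy
    rcases (hp y hy).2.2 with rfl | rfl | h'
    · exact Or.inl rfl
    · exact Or.inr Sym2.eq_swap
    · exact (h' huy).elim
  have huu : ∀ y, y ∈ p.support → H.Adj u y → s(u, y) ≠ s(u, s) → s(u, y) ≠ s(t, u) → False :=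
    fun y hy huy h1 h2 => (huadj y hy huy).elim h1 h2
  rcases ha with rfl | ha
  · rcases hb with rfl | hb
    · exact hab.ne rfl
    · exact huu b hb hab he.1 he.2.2
  · rcases hb with rfl | hb
    · rw [Sym2.eq_swap] at he
      exact huu a ha hab.symm he.1 he.2.2
    · -- a chord of the path yields a shorter walk
      have short : ∀ i j, i ≤ p.length → j ≤ p.length → i < j → H.Adj (p.getVert i) (p.getVert j) →
          s(p.getVert i, p.getVert j) ∉ p.edges → False := by
        intro i j hi hj hij hadj' hnot
        have hj1 : j ≠ i + 1 := by
          rintro rfl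
          apply hnot
          rw [SimpleGraph.Walk.mk_mem_edges_iff_exists]
          exact ⟨i, by omega, rfl⟩
        let q : H.Walk s t := (p.take i).append (SimpleGraph.Walk.cons hadj' (p.drop j))
        refine hadj (ih q.length ?_ q ?_ rfl)
        · simp only [q, SimpleGraph.Walk.length_append, SimpleGraph.Walk.length_cons,
            SimpleGraph.Walk.take_length, SimpleGraph.Walk.drop_length]
          omega
        · intro y hy
          apply hp
          simp only [q, SimpleGraph.Walk.mem_support_append_iff, SimpleGraph.Walk.support_cons,
            List.mem_cons] at hy
          rcases hy with hy | rfl | hy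
          · exact (p.isSubwalk_take i).support_subset hy
          · exact p.getVert_mem_support i
          · exact (p.isSubwalk_drop j).support_subset hy
      obtain ⟨i, rfl, hi⟩ := SimpleGraph.Walk.mem_support_iff_exists_getVert.1 ha
      obtain ⟨j, rfl, hj⟩ := SimpleGraph.Walk.mem_support_iff_exists_getVert.1 hb
      rcases lt_trichotomy i j with hij | rfl | hij
      · exact short i j hi hj hij hab he.2.1
      · exact hab.ne rfl
      · exact short j i hj hi hij hab.symm (by rw [Sym2.eq_swap]; exact he.2.1)

/-- A minimal element of a nonempty set for an acyclic relation on a finite type. -/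
theorem exists_minimal_of_acyclic [Finite V] {r : V → V → Prop}
    (hr : ∀ v, ¬ Relation.TransGen r v v) {S : Set V} (hS : S.Nonempty) :
    ∃ u ∈ S, ∀ w ∈ S, ¬ r w u := by
  have : IsTrans V (Relation.TransGen r) := ⟨fun _ _ _ => Relation.TransGen.trans⟩
  have : Std.Irrefl (Relation.TransGen r) := ⟨hr⟩
  have hwf := Finite.wellFounded_of_trans_of_irrefl (Relation.TransGen r)
  obtain ⟨u, hu, hmin⟩ := hwf.has_min S hS
  exact ⟨u, hu, fun w hw h => hmin w hw (Relation.TransGen.single h)⟩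

/-- A partial orientation of a chordal graph that is acyclic and closed under
`a → b`, `b ~ c`, `a ≁ c` implies `b → c` has a simplicial sink outside any clique that no directed
edge enters. -/
theorem ChordalOn.exists_sink [Finite V] {C : Set V} (hC : ChordalOn H C) {r : V → V → Prop}
    (hr : ∀ v, ¬ Relation.TransGen r v v)
    (hprop : ∀ a ∈ C, ∀ b ∈ C, ∀ c ∈ C, r a b → H.Adj b c → a ≠ c → ¬ H.Adj a c → r b c)
    (hle : ∀ a b, r a b → H.Adj a b) (S K : Set V) (hSC : S ⊆ C) (hKS : K ⊆ S)
    (hclique : ∀ x ∈ K, ∀ y ∈ K, x ≠ y → H.Adj x y)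
    (hin : ∀ a ∈ S, a ∉ K → ∀ b ∈ K, ¬ r a b) (hne : (S \ K).Nonempty) :
    ∃ x ∈ S \ K, (∀ y ∈ S, ¬ r x y) ∧
      ∀ y ∈ S, ∀ z ∈ S, H.Adj x y → H.Adj x z → y ≠ z → H.Adj y z := by
  induction hn : S.ncard using Nat.strong_induction_on generalizing S K with
  | _ n ih =>
  -- A source of `S`, taken inside `K` if possible: a minimal vertex of `K` is a source of all of
  -- `S`, because no edge enters `K` from the rest of `S`.
  obtain ⟨u, huS, hsrc, huK⟩ : ∃ u ∈ S, (∀ w ∈ S, ¬ r w u) ∧ (K.Nonempty → u ∈ K) := by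
    rcases K.eq_empty_or_nonempty with rfl | hK
    · obtain ⟨u, hu, hmin⟩ := exists_minimal_of_acyclic hr (hne.mono Set.sdiff_subset)
      exact ⟨u, hu, hmin, fun h => (Set.not_nonempty_empty h).elim⟩
    · obtain ⟨u, hu, hmin⟩ := exists_minimal_of_acyclic hr hK
      refine ⟨u, hKS hu, fun w hw => ?_, fun _ => hu⟩
      by_cases hwK : w ∈ K
      · exact hmin w hwK
      · exact hin w hw hwK u hu
  -- A source adjacent to all of `S` can be removed and put back: it receives no edge from the sink
  -- and enlarges cliques to cliques.
  by_cases huniv : ∀ w ∈ S, w ≠ u → H.Adj u w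
  · by_cases hne' : ((S \ {u}) \ (K \ {u})).Nonempty
    · obtain ⟨x, ⟨⟨hxS, hxu⟩, hxK⟩, hout, hsimp⟩ := ih (S \ {u}).ncard
        (hn ▸ Set.ncard_sdiff_singleton_lt_of_mem huS) (S \ {u}) (K \ {u})
        (Set.sdiff_subset.trans hSC) (Set.sdiff_subset_sdiff_left hKS)
        (fun x hx y hy => hclique x hx.1 y hy.1)
        (fun a ha haK b hb => hin a ha.1 (fun h => haK ⟨h, ha.2⟩) b hb.1) hne' rfl
      refine ⟨x, ⟨hxS, fun h => hxK ⟨h, hxu⟩⟩, fun y hy => ?_, fun y hy z hz hxy hxz hyz => ?_⟩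
      · by_cases hyu : y = u
        · exact hyu ▸ hsrc x hxS
        · exact hout y ⟨hy, hyu⟩
      · by_cases hyu : y = u
        · exact hyu ▸ huniv z hz (fun h => hyz (hyu.trans h.symm))
        · by_cases hzu : z = u
          · exact hzu ▸ (huniv y hy hyu).symm
          · exact hsimp y ⟨hy, hyu⟩ z ⟨hz, hzu⟩ hxy hxz hyz
    · have hall : ∀ w ∈ S, w ∉ K → w = u := by
        intro w hw hwK
        by_contra hwu
        exact hne' ⟨w, ⟨hw, hwu⟩, fun h => hwK h.1⟩
      obtain ⟨w, hw, hwK⟩ := hne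
      obtain rfl := hall w hw hwK
      have hK : ∀ y, y ∉ K := fun y hy => hwK (huK ⟨y, hy⟩)
      have hS : ∀ y ∈ S, y = w := fun y hy => hall y hy (hK y)
      refine ⟨w, ⟨hw, hwK⟩, fun y hy h => ?_, fun y hy z hz _ _ hyz => ?_⟩
      · exact (hle _ _ h).ne (hS y hy).symm
      · exact (hyz ((hS y hy).trans (hS z hz).symm)).elim
  · push Not at huniv
    obtain ⟨v, hvS, hvu, hv⟩ := huniv
    -- `B` is the component of `v` in `S` without the closed neighbourhood of `u`, and `N` is its
    -- boundary. By chordality `N` is a clique of neighbours of `u`. An edge from `b ∈ B` to `s ∈ N`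
    -- would propagate to `s → u`, but `u` is a source. So the induction applies to `B ∪ N` with
    -- clique `N`, and a vertex of `B` has all its neighbours in `S` within `B ∪ N`.
    let B : Set V := {w | ∃ p : H.Walk v w, ∀ y ∈ p.support, y ∈ S ∧ y ≠ u ∧ ¬ H.Adj u y}
    let N : Set V := {s | s ∈ S ∧ s ∉ B ∧ ∃ b ∈ B, H.Adj s b}
    have hB : ∀ b ∈ B, b ∈ S ∧ b ≠ u ∧ ¬ H.Adj u b :=
      fun b ⟨p, hp⟩ => hp b p.end_mem_support
    have hvB : v ∈ B := ⟨.nil, by simpa using ⟨hvS, hvu, hv⟩⟩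
    have hNadj : ∀ s ∈ N, H.Adj u s := by
      rintro s ⟨hs, hsB, b, ⟨p, hp⟩, hsb⟩
      by_contra hus
      refine hsB ⟨p.concat hsb.symm, fun y hy => ?_⟩
      rw [SimpleGraph.Walk.support_concat, List.mem_append,
        List.mem_singleton] at hy
      rcases hy with hy | rfl
      · exact hp y hy
      · refine ⟨hs, ?_, hus⟩
        rintro rfl
        exact (hB b ⟨p, hp⟩).2.2 hsb
    have hNclique : ∀ s ∈ N, ∀ t ∈ N, s ≠ t → H.Adj s t := by
      intro s hs t ht hst
      obtain ⟨hsS, hsB, b, ⟨p, hp⟩, hsb⟩ := id hs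
      obtain ⟨htS, htB, d, ⟨q, hq⟩, htd⟩ := id ht
      refine hC.adj_of_walk (hSC huS) (hNadj s hs) (hNadj t ht) hst
        (SimpleGraph.Walk.cons hsb ((p.reverse.append q).concat htd.symm)) fun y hy => ?_
      simp only [SimpleGraph.Walk.support_cons, SimpleGraph.Walk.support_concat, List.mem_cons, List.mem_append, List.mem_nil_iff, or_false,
        SimpleGraph.Walk.mem_support_append_iff, SimpleGraph.Walk.support_reverse,
        List.mem_reverse] at hy
      rcases hy with rfl | (hy | hy) | rfl
      · exact ⟨hSC hsS, (hNadj _ hs).ne', Or.inl rfl⟩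
      · exact ⟨hSC (hp y hy).1, (hp y hy).2.1, Or.inr (Or.inr (hp y hy).2.2)⟩
      · exact ⟨hSC (hq y hy).1, (hq y hy).2.1, Or.inr (Or.inr (hq y hy).2.2)⟩
      · exact ⟨hSC htS, (hNadj _ ht).ne', Or.inr (Or.inl rfl)⟩
    have hBNS : B ∪ N ⊆ S := Set.union_subset (fun b hb => (hB b hb).1) fun s hs => hs.1
    have huBN : u ∉ B ∪ N := by
      rintro (h | h)
      · exact (hB u h).2.1 rfl
      · exact (hNadj u h).ne rfl
    have hlt : (B ∪ N).ncard < S.ncard :=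
      Set.ncard_lt_ncard ⟨hBNS, fun h => huBN (h huS)⟩
    obtain ⟨x, ⟨hx, hxN⟩, hout, hsimp⟩ := ih (B ∪ N).ncard (hn ▸ hlt) (B ∪ N) N
      (hBNS.trans hSC) Set.subset_union_right hNclique
      (by
        rintro b (hb | hb) hbN s hs hbs
        · refine hsrc s hs.1 (hprop b (hSC (hB b hb).1) s (hSC hs.1) u (hSC huS) hbs
            (hNadj s hs).symm (hB b hb).2.1 fun h => (hB b hb).2.2 h.symm)
        · exact hbN hb)
      ⟨v, Or.inl hvB, fun h => h.2.1 hvB⟩ rfl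
    have hxB : x ∈ B := hx.resolve_right hxN
    have hnbr : ∀ y ∈ S, H.Adj x y → y ∈ B ∪ N := by
      intro y hy hxy
      by_cases hyB : y ∈ B
      · exact Or.inl hyB
      · exact Or.inr ⟨hy, hyB, x, hxB, hxy.symm⟩
    refine ⟨x, ⟨(hB x hxB).1, fun hxK => ?_⟩, fun y hy h => ?_, fun y hy z hz hxy hxz hyz => ?_⟩
    -- If `x` were in the clique `K`, then so would `u` be, and the two would be adjacent.
    · exact (hB x hxB).2.2 (hclique u (huK ⟨x, hxK⟩) x hxK (hB x hxB).2.1.symm)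
    · exact hout y (hnbr y hy (hle _ _ h)) h
    · exact hsimp y (hnbr y hy hxy) z (hnbr z hz hxz) hxy hxz hyz

end Chordal

end CausalGraph

/-! ### Orienting a single undirected edge. -/

namespace CausalGraph

/-- Adding the pair `(y, x)` to an acyclic relation in which `y` cannot be reached from `x` keeps it
acyclic. -/
theorem acyclic_insert {V : Type*} {r : V → V → Prop} (hr : ∀ v, ¬ Relation.TransGen r v v)
    {x y : V} (hxy : ¬ Relation.ReflTransGen r x y) (v : V) :
    ¬ Relation.TransGen (fun u w => r u w ∨ (u = y ∧ w = x)) v v := by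
  have key : ∀ u w, Relation.TransGen (fun u w => r u w ∨ (u = y ∧ w = x)) u w →
      Relation.TransGen r u w ∨ (Relation.ReflTransGen r u y ∧ Relation.ReflTransGen r x w) := by
    intro u w h
    induction h with
    | single h =>
      rcases h with h | ⟨rfl, rfl⟩
      · exact Or.inl (.single h)
      · exact Or.inr ⟨.refl, .refl⟩
    | tail _ h ih =>
      rcases h with h | ⟨rfl, rfl⟩
      · exact ih.imp (fun ih => ih.tail h) fun ih => ⟨ih.1, ih.2.tail h⟩
      · exact ih.elim (fun ih => Or.inr ⟨ih.to_reflTransGen, .refl⟩) fun ih => Or.inr ⟨ih.1, .refl⟩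
  intro h
  rcases key v v h with h | ⟨h1, h2⟩
  · exact hr v h
  · exact hxy (h2.trans h1)

namespace PDAG

variable {V : Type*} {G G' : PDAG V}

theorem skeleton_of_dir {a b : V} (h : G.dir a b) : G.skeleton.Adj a b := Or.inl h

theorem skeleton_of_und {a b : V} (h : G.und.Adj a b) : G.skeleton.Adj a b := Or.inr (Or.inr h)

theorem not_dir_symm {a b : V} (h : G.dir a b) : ¬ G.dir b a :=
  fun h' => G.acyclic a ((Relation.TransGen.single h).tail h')

theorem not_dir_of_dir_dir {a b c : V} (h : G.dir a b) (h' : G.dir b c) : ¬ G.dir c a :=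
  fun h'' => G.acyclic a (((Relation.TransGen.single h).tail h').tail h'')

/-- `G` with the undirected edge `y - x` replaced by `y → x`. -/
def orientEdge (G : PDAG V) (y x : V) (hxy : ¬ Relation.ReflTransGen G.dir x y) : PDAG V where
  dir u v := G.dir u v ∨ (u = y ∧ v = x)
  und := G.und.deleteEdges {s(y, x)}
  not_both a b h h' := by
    rw [SimpleGraph.deleteEdges_adj] at h'
    rcases h with h | ⟨rfl, rfl⟩
    · exact G.not_both a b h h'.1
    · exact h'.2 rfl
  acyclic := acyclic_insert G.acyclic hxy

theorem orientEdge_und_adj {y x : V} {hxy : ¬ Relation.ReflTransGen G.dir x y} {u v : V} :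
    (G.orientEdge y x hxy).und.Adj u v ↔ G.und.Adj u v ∧ s(u, v) ≠ s(y, x) := by
  change (G.und.deleteEdges {s(y, x)}).Adj u v ↔ _
  simp [SimpleGraph.deleteEdges_adj]

theorem OrientsOneEdge.skeleton_eq (h : G.OrientsOneEdge G') : G'.skeleton = G.skeleton := by
  obtain ⟨a, b, hab, hund, hdir⟩ := h
  ext u v
  have hu : G'.und.Adj u v ↔ G.und.Adj u v ∧ s(u, v) ≠ s(a, b) := by
    rw [hund]; simp [SimpleGraph.deleteEdges_adj]
  change G'.dir u v ∨ G'.dir v u ∨ G'.und.Adj u v ↔ G.dir u v ∨ G.dir v u ∨ G.und.Adj u v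
  rw [hdir, hdir, hu, Ne, Sym2.eq_iff]
  have h1 : u = a ∧ v = b → G.und.Adj u v := by rintro ⟨rfl, rfl⟩; exact hab
  have h2 : u = b ∧ v = a → G.und.Adj u v := by rintro ⟨rfl, rfl⟩; exact hab.symm
  tauto

/-- Orienting an undirected edge of a graph without `a → b - c` creates no v-structure. -/
theorem OrientsOneEdge.isVStructure (h : G.OrientsOneEdge G')
    (hG : ∀ a b c, ¬ G.Forbidden₁ a b c) {a b c : V} (hv : G'.IsVStructure a b c) :
    G.IsVStructure a b c := by
  have hskel := h.skeleton_eq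
  obtain ⟨y, x, hyx, -, hdir⟩ := h
  obtain ⟨hab, hcb, hac, hn⟩ := hv
  rw [hdir] at hab hcb
  rw [hskel] at hn
  rcases hab with hab | ⟨rfl, rfl⟩
  · rcases hcb with hcb | ⟨rfl, rfl⟩
    · exact ⟨hab, hcb, hac, hn⟩
    · exact (hG _ _ _ ⟨hab, hyx.symm, hn⟩).elim
  · rcases hcb with hcb | ⟨rfl, -⟩
    · exact (hG _ _ _ ⟨hcb, hyx.symm, fun h' => hn h'.symm⟩).elim
    · exact (hac rfl).elim

/-- Any DAG found after an orientation is already represented before it. This drives the inductions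
on the number of undirected edges and gives the order relation for an orientation step. -/
theorem OrientsOneEdge.represents (h : G.OrientsOneEdge G') (hG : ∀ a b c, ¬ G.Forbidden₁ a b c)
    {D : PDAG V} (hD : G'.Represents D) : G.Represents D := by
  refine ⟨hD.1, hD.2.1.trans h.skeleton_eq, fun a b hab => hD.2.2.1 a b ?_,
    fun a b c hv => h.isVStructure hG (hD.2.2.2 a b c hv)⟩
  obtain ⟨y, x, -, -, hdir⟩ := h
  exact (hdir a b).2 (Or.inl hab)

theorem OrientsOneEdge.numUndirected_eq [Finite V] (h : G.OrientsOneEdge G') :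
    G.numUndirected = G'.numUndirected + 1 := by
  obtain ⟨a, b, hab, hund, -⟩ := h
  unfold numUndirected
  rw [hund, SimpleGraph.edgeSet_deleteEdges]
  exact (Set.ncard_sdiff_singleton_add_one (G.und.mem_edgeSet.2 hab)).symm

theorem OrientsOneEdge.numDirected_eq [Finite V] (h : G.OrientsOneEdge G') :
    G'.numDirected = G.numDirected + 1 := by
  obtain ⟨a, b, hab, -, hdir⟩ := h
  unfold numDirected
  rw [← Set.ncard_insert_of_notMem (a := (a, b)) (fun h' => G.not_both a b h' hab)]
  congr 1
  ext ⟨u, v⟩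
  simp [hdir, or_comm]

/-! ### Undirected components of an MPDAG and the existence of orientations. -/

namespace IsMPDAG

theorem chordalOn (hG : G.IsMPDAG) (a : V) : ChordalOn G.skeleton {x | G.und.Reachable a x} := by
  have h := (chordal_induce_iff _).1 (hG.1 (G.und.connectedComponentMk a))
  refine h.mono fun x hx => ?_
  rw [SimpleGraph.ConnectedComponent.mem_supp_iff, SimpleGraph.ConnectedComponent.eq]
  exact SimpleGraph.Reachable.symm hx

/-- A directed edge entering an undirected component from outside points to all of it. -/
theorem dir_of_not_reachable (hG : G.IsMPDAG) {p b c : V} (hpb : G.dir p b)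
    (hp : ¬ G.und.Reachable p b) (hbc : G.und.Reachable b c) : G.dir p c := by
  have hbc' := (SimpleGraph.reachable_iff_reflTransGen _ _).1 hbc
  clear hbc
  induction hbc' with
  | refl => exact hpb
  | @tail c d hbc hcd ih =>
    have hbd : G.und.Reachable b d :=
      ((SimpleGraph.reachable_iff_reflTransGen _ _).2 hbc).trans hcd.reachable
    by_contra hpd
    have hadj : G.skeleton.Adj p d := by
      by_contra hn
      exact hG.2.1 _ _ _ ⟨ih, hcd, hn⟩
    rcases hadj with h | h | h
    · exact hpd h
    · exact hG.2.2.1 _ _ _ ⟨h, ih, hcd.symm⟩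
    · exact hp (h.reachable.trans hbd.symm)

/-- Within an undirected component there are no v-structures. -/
theorem adj_of_dir_dir (hG : G.IsMPDAG) {a b c : V} (hab : G.dir a b) (hcb : G.dir c b)
    (hac : a ≠ c) (hr : G.und.Reachable b a) : G.skeleton.Adj a c := by
  by_contra hn
  have hr' := (SimpleGraph.reachable_iff_reflTransGen _ _).1 hr
  -- The four rules force both arrows to propagate along undirected edges; carried back to `a` they
  -- give the loop `a → a`.
  have key : ∀ y, Relation.ReflTransGen G.und.Adj b y → G.dir a y ∧ G.dir c y := by
    intro y hy
    induction hy with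
    | refl => exact ⟨hab, hcb⟩
    | @tail y z _ hyz ih =>
      obtain ⟨hay, hcy⟩ := ih
      have haz : G.skeleton.Adj a z := by
        by_contra h
        exact hG.2.1 _ _ _ ⟨hay, hyz, h⟩
      have hcz : G.skeleton.Adj c z := by
        by_contra h
        exact hG.2.1 _ _ _ ⟨hcy, hyz, h⟩
      rcases haz with haz | haz | haz
      · rcases hcz with hcz | hcz | hcz
        · exact ⟨haz, hcz⟩
        · exact (hG.2.2.1 _ _ _ ⟨hcz, hcy, hyz.symm⟩).elim
        · exact (hG.2.1 _ _ _ ⟨haz, hcz.symm, hn⟩).elim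
      · exact (hG.2.2.1 _ _ _ ⟨haz, hay, hyz.symm⟩).elim
      · rcases hcz with hcz | hcz | hcz
        · exact (hG.2.1 _ _ _ ⟨hcz, haz.symm, fun h => hn h.symm⟩).elim
        · exact (hG.2.2.1 _ _ _ ⟨hcz, hcy, hyz.symm⟩).elim
        · exact (hG.2.2.2.1 _ _ _ _ ⟨haz.symm, hcz.symm, hyz.symm, hay, hcy, hac, hn⟩).elim
  exact G.acyclic a (.single (key a hr').1)

/-- Directed paths of length two whose last edge stays in an undirected component are shielded. -/
theorem dir_of_dir_dir (hG : G.IsMPDAG) {w t a : V} (hwt : G.dir w t) (hta : G.dir t a)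
    (hr : G.und.Reachable a t) : G.dir w a := by
  have hadj : G.skeleton.Adj w a := by
    by_contra hn
    have hr' := (SimpleGraph.reachable_iff_reflTransGen _ _).1 hr
    -- Propagation again: `t → y` and the non-adjacency of `w` and `y` survive each undirected step,
    -- and reaching `t` gives the loop `t → t`.
    have key : ∀ y, Relation.ReflTransGen G.und.Adj a y → G.dir t y ∧ ¬ G.skeleton.Adj w y := by
      intro y hy
      induction hy with
      | refl => exact ⟨hta, hn⟩
      | @tail y z _ hyz ih =>
        obtain ⟨hty, hwy⟩ := ih
        have htz : G.skeleton.Adj t z := by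
          by_contra h
          exact hG.2.1 _ _ _ ⟨hty, hyz, h⟩
        rcases htz with htz | htz | htz
        · refine ⟨htz, ?_⟩
          rintro (h | h | h)
          · exact hG.2.1 _ _ _ ⟨h, hyz.symm, hwy⟩
          · exact not_dir_of_dir_dir hwt htz h
          · exact hG.2.2.1 _ _ _ ⟨hwt, htz, h⟩
        · exact (hG.2.2.1 _ _ _ ⟨htz, hty, hyz.symm⟩).elim
        · exfalso
          have hwz : G.skeleton.Adj w z := by
            by_contra h
            exact hG.2.1 _ _ _ ⟨hwt, htz, h⟩
          rcases hwz with h | h | h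
          · exact hG.2.1 _ _ _ ⟨h, hyz.symm, hwy⟩
          · exact hG.2.2.1 _ _ _ ⟨h, hwt, htz.symm⟩
          · exact hG.2.2.2.2 _ _ _ _ ⟨h.symm, hyz.symm, htz.symm, hwt, hty, hwy⟩
    exact G.acyclic t (.single (key t hr').1)
  rcases hadj with h | h | h
  · exact h
  · exact (not_dir_of_dir_dir hwt hta h).elim
  · exact (hG.2.2.1 _ _ _ ⟨hwt, hta, h⟩).elim

/-- An undirected component with an edge at `a` has a simplicial sink other than `a`. -/
theorem exists_sink [Finite V] (hG : G.IsMPDAG) {a b : V} (hab : G.und.Adj a b) :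
    ∃ x, x ≠ a ∧ G.und.Reachable a x ∧ (∀ y, G.und.Reachable a y → ¬ G.dir x y) ∧
      ∀ y z, G.und.Reachable a y → G.und.Reachable a z → G.skeleton.Adj x y →
        G.skeleton.Adj x z → y ≠ z → G.skeleton.Adj y z := by
  have hprop : ∀ u ∈ {x | G.und.Reachable a x}, ∀ v ∈ {x | G.und.Reachable a x},
      ∀ w ∈ {x | G.und.Reachable a x}, G.dir u v → G.skeleton.Adj v w → u ≠ w →
        ¬ G.skeleton.Adj u w → G.dir v w := by
    intro u hu v hv w hw huv hvw huw hn
    rcases hvw with h | h | h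
    · exact h
    · exact (hn (hG.adj_of_dir_dir huv h huw (SimpleGraph.Reachable.trans hv.symm hu))).elim
    · exact (hG.2.1 _ _ _ ⟨huv, h, hn⟩).elim
  -- The clique to be avoided is `a` with its parents inside the component: absence of v-structures
  -- makes it a clique, and `dir_of_dir_dir` makes it closed under parents in the component. The
  -- vertex `b` lies outside it.
  obtain ⟨x, ⟨hx, hxK⟩, hout, hsimp⟩ := (hG.chordalOn a).exists_sink G.acyclic hprop
    (fun _ _ => skeleton_of_dir) {x | G.und.Reachable a x}
    {x | G.und.Reachable a x ∧ (x = a ∨ G.dir x a)} le_rfl (fun x hx => hx.1)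
    (by
      rintro y ⟨hy, rfl | hya⟩ z ⟨hz, rfl | hza⟩ hyz
      · exact (hyz rfl).elim
      · exact (skeleton_of_dir hza).symm
      · exact skeleton_of_dir hya
      · exact hG.adj_of_dir_dir hya hza hyz hy)
    (by
      rintro y hy hyK z ⟨hz, rfl | hza⟩ hyz
      · exact hyK ⟨hy, Or.inr hyz⟩
      · exact hyK ⟨hy, Or.inr (hG.dir_of_dir_dir hyz hza hz)⟩)
    ⟨b, hab.reachable, by
      rintro ⟨-, h | h⟩
      · exact hab.ne h.symm
      · exact G.not_both _ _ h hab.symm⟩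
  exact ⟨x, fun h => hxK ⟨hx, Or.inl h⟩, hx, hout, fun y z hy hz => hsimp y hy z hz⟩

/-- Orienting into a simplicial sink `x` of its undirected component the undirected edge from a
minimal undirected neighbour `y` gives an MPDAG. -/
theorem orientEdge (hG : G.IsMPDAG) {x y : V} (hyx : G.und.Adj y x)
    (hout : ∀ z, G.und.Reachable x z → ¬ G.dir x z)
    (hsimp : ∀ z, G.und.Adj x z → y ≠ z → G.skeleton.Adj y z)
    (hmin : ∀ z, G.und.Adj x z → ¬ G.dir z y) (hxy : ¬ Relation.ReflTransGen G.dir x y) :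
    (G.orientEdge y x hxy).IsMPDAG := by
  have hskel : (G.orientEdge y x hxy).skeleton = G.skeleton :=
    OrientsOneEdge.skeleton_eq ⟨y, x, hyx, rfl, fun _ _ => Iff.rfl⟩
  have hle : (G.orientEdge y x hxy).und ≤ G.und := SimpleGraph.deleteEdges_le _
  refine ⟨fun C => ?_, ?_, ?_, ?_, ?_⟩
  · rw [hskel, chordal_induce_iff]
    induction C using SimpleGraph.ConnectedComponent.ind with
    | _ v =>
    refine (hG.chordalOn v).mono fun w hw => ?_
    rw [SimpleGraph.ConnectedComponent.mem_supp_iff, SimpleGraph.ConnectedComponent.eq] at hw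
    exact (hw.mono hle).symm
  · rintro p q r ⟨hpq, hqr, hpr⟩
    rw [hskel] at hpr
    rw [orientEdge_und_adj] at hqr
    rcases hpq with hpq | ⟨rfl, rfl⟩
    · exact hG.2.1 _ _ _ ⟨hpq, hqr.1, hpr⟩
    · refine hpr (hsimp r hqr.1 ?_)
      rintro rfl
      exact hqr.2 Sym2.eq_swap
  · rintro p q r ⟨hpq, hqr, hpr⟩
    replace hpr := hle hpr
    rcases hpq with hpq | ⟨rfl, rfl⟩
    · rcases hqr with hqr | ⟨rfl, rfl⟩
      · exact hG.2.2.1 _ _ _ ⟨hpq, hqr, hpr⟩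
      · exact hmin p hpr.symm hpq
    · rcases hqr with hqr | ⟨rfl, -⟩
      · exact hout r (hyx.symm.reachable.trans hpr.reachable) hqr
      · exact hyx.ne rfl
  · rintro p b c d ⟨hpb, hpc, hpd, hbd, hcd, hbc, hn⟩
    rw [hskel] at hn
    replace hpb := hle hpb
    replace hpc := hle hpc
    replace hpd := hle hpd
    rcases hbd with hbd | ⟨rfl, rfl⟩
    · rcases hcd with hcd | ⟨rfl, rfl⟩
      · exact hG.2.2.2.1 _ _ _ _ ⟨hpb, hpc, hpd, hbd, hcd, hbc, hn⟩
      · exact hG.2.1 _ _ _ ⟨hbd, hyx.symm, hn⟩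
    · rcases hcd with hcd | ⟨rfl, -⟩
      · exact hG.2.1 _ _ _ ⟨hcd, hyx.symm, fun h => hn h.symm⟩
      · exact hbc rfl
  · rintro p b c d ⟨hpb, hpc, hpd, hbd, hdc, hn⟩
    rw [hskel] at hn
    replace hpb := hle hpb
    replace hpc := hle hpc
    replace hpd := hle hpd
    rcases hbd with hbd | ⟨rfl, rfl⟩
    · rcases hdc with hdc | ⟨rfl, rfl⟩
      · exact hG.2.2.2.2 _ _ _ _ ⟨hpb, hpc, hpd, hbd, hdc, hn⟩
      · exact hG.2.1 _ _ _ ⟨hbd, hyx, hn⟩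
    · rcases hdc with hdc | ⟨rfl, -⟩
      · exact hout c (hpd.symm.reachable.trans hpc.reachable) hdc
      · exact hyx.ne rfl

/-- In an MPDAG with an undirected edge at `a`, some undirected edge can be oriented, not into `a`,
so that the result is again an MPDAG. -/
theorem exists_orient [Finite V] (hG : G.IsMPDAG) {a b : V} (hab : G.und.Adj a b) :
    ∃ G' : PDAG V, G'.IsMPDAG ∧ ∃ y x, x ≠ a ∧ G.und.Adj y x ∧
      G'.und = G.und.deleteEdges {s(y, x)} ∧ ∀ u v, G'.dir u v ↔ G.dir u v ∨ (u = y ∧ v = x) := by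
  obtain ⟨x, hxa, hax, hout, hsimp⟩ := hG.exists_sink hab
  have hne : {y | G.und.Adj x y}.Nonempty := by
    have h := (SimpleGraph.reachable_iff_reflTransGen _ _).1 hax.symm
    rcases Relation.ReflTransGen.cases_head h with h | ⟨y, hy, -⟩
    · exact (hxa h).elim
    · exact ⟨y, hy⟩
  obtain ⟨y, hy, hmin⟩ := exists_minimal_of_acyclic G.acyclic hne
  -- A directed path leaving `x` never meets the component again: the edge by which it re-enters
  -- would come with an edge to `x` itself, closing a cycle. So `y → x` creates no directed cycle.
  have hr : ∀ z, Relation.TransGen G.dir x z → ¬ G.und.Reachable a z := by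
    intro z hz
    induction hz with
    | single h => exact fun h' => hout _ h' h
    | tail hxz h ih =>
      intro h'
      have := hG.dir_of_not_reachable h (fun h'' => ih (h'.trans h''.symm)) (h'.symm.trans hax)
      exact G.acyclic x (hxz.tail this)
  have hxy : ¬ Relation.ReflTransGen G.dir x y := by
    intro h
    rcases Relation.reflTransGen_iff_eq_or_transGen.1 h with h | h
    · exact (SimpleGraph.Adj.ne hy) h.symm
    · exact hr y h (hax.trans (SimpleGraph.Adj.reachable hy))
  refine ⟨G.orientEdge y x hxy, hG.orientEdge hy.symm (fun z hz => hout z (hax.trans hz))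
    (fun z hz hyz => ?_) hmin hxy, y, x, hxa, hy.symm, rfl, fun _ _ => Iff.rfl⟩
  exact hsimp y z (hax.trans (SimpleGraph.Adj.reachable hy)) (hax.trans hz.reachable)
    (skeleton_of_und hy) (skeleton_of_und hz) hyz

theorem exists_represents [Finite V] (hG : G.IsMPDAG) : ∃ D, G.Represents D := by
  induction hn : G.numUndirected using Nat.strong_induction_on generalizing G with
  | _ n ih =>
  by_cases h : G.und = ⊥
  · exact ⟨G, h, rfl, fun _ _ => id, fun _ _ _ => id⟩
  · obtain ⟨a, b, hab⟩ := SimpleGraph.ne_bot_iff_exists_adj.1 h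
    obtain ⟨G', hG', y, x, -, hor⟩ := hG.exists_orient hab
    have hor' : G.OrientsOneEdge G' := ⟨y, x, hor⟩
    obtain ⟨D, hD⟩ := ih _ (by have := hor'.numUndirected_eq; omega) hG' rfl
    exact ⟨D, hor'.represents hG.2.1 hD⟩

/-- Every orientation of every undirected edge of an MPDAG occurs in a DAG that it represents. -/
theorem exists_represents_dir [Finite V] (hG : G.IsMPDAG) {a b : V} (hab : G.und.Adj a b) :
    ∃ D, G.Represents D ∧ D.dir a b := by
  induction hn : G.numUndirected using Nat.strong_induction_on generalizing G with
  | _ n ih =>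
  obtain ⟨G', hG', y, x, hxa, hyx, hund, hdir⟩ := hG.exists_orient hab
  have hor : G.OrientsOneEdge G' := ⟨y, x, hyx, hund, hdir⟩
  -- Orientations never point into `a`, so when the edge between `a` and `b` is finally oriented, it
  -- becomes `a → b`.
  by_cases he : s(a, b) = s(y, x)
  · rcases Sym2.eq_iff.1 he with ⟨rfl, rfl⟩ | ⟨h, -⟩
    · obtain ⟨D, hD⟩ := hG'.exists_represents
      exact ⟨D, hor.represents hG.2.1 hD, hD.2.2.1 _ _ ((hdir _ _).2 (Or.inr ⟨rfl, rfl⟩))⟩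
    · exact (hxa h.symm).elim
  · obtain ⟨D, hD, hDab⟩ := ih _ (by have := hor.numUndirected_eq; omega) hG'
      (by rw [hund, SimpleGraph.deleteEdges_adj]; exact ⟨hab, he⟩) rfl
    exact ⟨D, hor.represents hG.2.1 hD, hDab⟩

end IsMPDAG
end PDAG
end CausalGraph

namespace CausalGraph

/-! ### Independence of shifted fair coins. -/

section Independence

variable {ι Ω Ω' : Type*} {β : ι → Type*} [∀ i, MeasurableSpace (β i)]
  [MeasurableSpace Ω] [MeasurableSpace Ω']

/-- Independence passes to the image measure. -/
theorem iIndepFun_map [Finite ι] {μ : Measure Ω} [IsProbabilityMeasure μ] {T : Ω → Ω'} (hT : Measurable T)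
    {f : ∀ i, Ω' → β i} (hf : ∀ i, Measurable (f i))
    (h : iIndepFun (fun i ω => f i (T ω)) μ) : iIndepFun f (μ.map T) := by
  have := Fintype.ofFinite ι
  have := Measure.isProbabilityMeasure_map hT.aemeasurable (μ := μ)
  rw [iIndepFun_iff_map_fun_eq_pi_map fun i => (hf i).aemeasurable]
  have h' := h.map_fun_eq_pi_map fun i => ((hf i).comp hT).aemeasurable
  rw [Measure.map_map (measurable_pi_lambda _ hf) hT]
  refine h'.trans ?_
  congr 1
  funext i
  rw [Measure.map_map (hf i) hT]

/-- The coordinates of a random vector whose law is a product measure are independent. -/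
theorem iIndepFun_of_map_eq_pi [Fintype ι] {μ : Measure Ω} [IsProbabilityMeasure μ]
    {ν : ∀ i, Measure (β i)} [∀ i, IsProbabilityMeasure (ν i)] {F : Ω → ∀ i, β i}
    (hF : Measurable F) (h : μ.map F = Measure.pi ν) : iIndepFun (fun i ω => F ω i) μ := by
  rw [iIndepFun_iff_map_fun_eq_pi_map (f := fun i ω => F ω i)
    fun i => ((measurable_pi_apply i).comp hF).aemeasurable]
  refine h.trans ?_
  congr 1
  funext i
  have : (fun ω => F ω i) = (fun x : ∀ i, β i => x i) ∘ F := rfl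
  rw [this, ← Measure.map_map (measurable_pi_apply i) hF, h]
  exact ((measurePreserving_eval ν i).map_eq).symm

/-- A property of finitely many observables that holds on the finite support of a law holds almost
surely. -/
theorem ae_map_of_finite [Finite Ω] {Y : Type*} [MeasurableSpace Y] [MeasurableSingletonClass Y]
    {μ : Measure Ω} {T : Ω → Ω'} (hT : Measurable T) {F : Ω' → Y} (hF : Measurable F) {q : Y → Prop}
    (h : ∀ ω, q (F (T ω))) : ∀ᵐ ω ∂(μ.map T), q (F ω) := by
  -- The event defined by `q` need not be measurable; the finite set of attained values is.
  have hmeas : MeasurableSet (F ⁻¹' Set.range (F ∘ T)) :=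
    hF (Set.finite_range _).measurableSet
  have : ∀ᵐ ω ∂(μ.map T), ω ∈ F ⁻¹' Set.range (F ∘ T) :=
    (ae_map_iff hT.aemeasurable hmeas).2 (Filter.Eventually.of_forall fun ω => ⟨ω, rfl⟩)
  filter_upwards [this] with ω ⟨ω', hω'⟩
  exact hω' ▸ h ω'

/-- A fair coin. -/
noncomputable def coin : Measure Bool := (PMF.uniformOfFintype Bool).toMeasure

instance : IsProbabilityMeasure coin := PMF.toMeasure.isProbabilityMeasure _

theorem coin_singleton (b : Bool) : coin {b} = 2⁻¹ := by
  rw [coin, PMF.toMeasure_apply_singleton _ _ (measurableSet_singleton b)]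
  simp

theorem map_xor_coin (k : Bool) : coin.map (fun b => xor b k) = coin := by
  refine Measure.ext_of_singleton fun b => ?_
  rw [Measure.map_apply (measurable_of_finite _) (measurableSet_singleton b)]
  have : (fun b => xor b k) ⁻¹' {b} = {xor b k} := by
    ext a
    cases a <;> cases b <;> cases k <;> simp
  rw [this, coin_singleton, coin_singleton]

/-- Fair coins, shifted by bits that depend on an independent variable, are independent. -/
theorem iIndepFun_xor_coin [Fintype ι] [Finite Ω] [MeasurableSingletonClass Ω] (κ : Measure Ω)
    [IsProbabilityMeasure κ] (k : Ω → ι → Bool) :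
    iIndepFun (fun i (p : Ω × (ι → Bool)) => xor (p.2 i) (k p.1 i))
      (κ.prod (Measure.pi fun _ => coin)) := by
  -- For each fixed value of the first coordinate the shift preserves the law of the coins, hence so
  -- does the skew product.
  have hskew : MeasurePreserving (fun p : Ω × (ι → Bool) => (p.1, fun i => xor (p.2 i) (k p.1 i)))
      (κ.prod (Measure.pi fun _ => coin)) (κ.prod (Measure.pi fun _ => coin)) := by
    refine (MeasurePreserving.id κ).skew_product (g := fun (z : Ω) (c : ι → Bool) i => xor (c i) (k z i))
      (measurable_of_finite _) (Filter.Eventually.of_forall fun z => ?_)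
    have h := Measure.pi_map_pi (μ := fun _ : ι => coin) (f := fun i b => xor b (k z i))
      fun i => (measurable_of_finite _).aemeasurable
    simp only [map_xor_coin] at h
    exact h
  have h := measurePreserving_snd.comp hskew
  exact iIndepFun_of_map_eq_pi h.measurable h.map_eq

end Independence

/-! ### A law that detects every edge of a DAG. -/

section Witness

variable {V : Type*} {X : V → Type*}

open Classical in
/-- The schedule in which the vertex `v` takes the value coded by its coin `c v`, except that for an
active edge `z = (a, b)` of `r` the value of `b` is shifted by the bit of `a`. -/
noncomputable def edgeSchedule (r : V → V → Prop) (e : ∀ v, Bool → X v)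
    (p : Option (V × V) × (V → Bool)) : Schedule X := fun v I x =>
  e v (xor (p.2 v) (p.1.elim false fun z => if r z.1 z.2 ∧ v = z.2 then
    (if h : z.1 ∈ I then decide (x ⟨z.1, h⟩ = e z.1 true) else p.2 z.1) else false))

open Classical in
theorem edgeSchedule_none (r : V → V → Prop) (e : ∀ v, Bool → X v) (c : V → Bool) (v : V)
    (I : Set V) (x : ∀ v, X v) : (edgeSchedule r e (none, c)).outcome v I x = e v (c v) := by
  simp [Schedule.outcome, edgeSchedule]

open Classical in
theorem edgeSchedule_some (r : V → V → Prop) (e : ∀ v, Bool → X v) (a b : V) (c : V → Bool) (v : V)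
    (I : Set V) (x : ∀ v, X v) : (edgeSchedule r e (some (a, b), c)).outcome v I x =
      e v (xor (c v) (if r a b ∧ v = b then
        (if a ∈ I then decide (x a = e a true) else c a) else false)) := by
  by_cases ha : a ∈ I <;> simp [Schedule.outcome, edgeSchedule, ha]

variable [∀ v, MeasurableSpace (X v)]

theorem measurable_outcome (v : V) (I : Set V) (x : ∀ v, X v) :
    Measurable fun ω : Schedule X => ω.outcome v I x := by
  unfold Schedule.outcome
  fun_prop

variable [Finite V] [∀ v, MeasurableSingletonClass (X v)] [∀ v, Nontrivial (X v)]

/-- Every DAG has a law in its model at which each of its edges is active with positive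
probability: that law lies in the model of another DAG only if that DAG has all these edges. -/
theorem exists_faithful (D : PDAG V) : ∃ P ∈ dagModel X D, ∀ D' : PDAG V, P ∈ dagModel X D' →
    ∀ a b, D.dir a b → D'.dir a b := by
  classical
  have := Fintype.ofFinite V
  have he : ∀ v, ∃ f : Bool → X v, f false ≠ f true := fun v => by
    obtain ⟨y, z, hyz⟩ := exists_pair_ne (X v)
    exact ⟨fun b => if b then z else y, by simpa using hyz⟩
  choose e he using he
  have hbit : ∀ v b, decide (e v b = e v true) = b := by
    intro v b
    cases b
    · simpa using he v
    · simp
  let : MeasurableSpace (Option (V × V)) := ⊤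
  have : DiscreteMeasurableSpace (Option (V × V)) := ⟨fun _ => trivial⟩
  -- At most one edge is active at a time, chosen at random: the outcomes are explicit, with no
  -- recursion along the DAG, and each edge is still active with positive probability.
  let κ : Measure (Option (V × V)) := (PMF.uniformOfFintype (Option (V × V))).toMeasure
  have : IsProbabilityMeasure κ := PMF.toMeasure.isProbabilityMeasure _
  let μ : Measure (Option (V × V) × (V → Bool)) := κ.prod (Measure.pi fun _ => coin)
  let T : Option (V × V) × (V → Bool) → Schedule X := edgeSchedule D.dir e
  have hT : Measurable T := measurable_of_finite _
  have hpos : ∀ z c, μ {(z, c)} ≠ 0 := by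
    intro z c
    rw [← Set.singleton_prod_singleton, Measure.prod_prod, ← Set.univ_pi_singleton,
      Measure.pi_pi]
    simp only [coin_singleton]
    refine mul_ne_zero ?_ ?_
    · rw [PMF.toMeasure_apply_singleton _ _ (measurableSet_singleton z),
        PMF.uniformOfFintype_apply]
      exact ENNReal.inv_ne_zero.2 (ENNReal.natCast_ne_top _)
    · simp [Finset.prod_const]
  have hae : ∀ q : Option (V × V) × (V → Bool) → Prop, (∀ᵐ p ∂μ, q p) → ∀ p, q p := by
    intro q hq p
    by_contra hp
    refine hpos p.1 p.2 (measure_mono_null ?_ (ae_iff.1 hq))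
    rintro _ rfl
    exact hp
  refine ⟨μ.map T, ⟨⟨Measure.isProbabilityMeasure_map hT.aemeasurable, ?_⟩, ?_, ?_⟩, ?_⟩
  · intro I I' x hI
    refine ae_map_of_finite (Y := (∀ v, X v) × (∀ v, X v)) (T := T)
      (F := fun ω => (fun v => ω.outcome v I x, fun v => ω.outcome v (I ∪ I') x))
      (q := fun y => (∀ i ∈ I', y.1 i = x i) → ∀ v, y.2 v = y.1 v) hT
      ((measurable_pi_lambda _ fun v => measurable_outcome v I x).prodMk
        (measurable_pi_lambda _ fun v => measurable_outcome v _ x)) ?_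
    rintro ⟨z, c⟩ h v
    simp only [T] at h ⊢
    rcases z with _ | ⟨a, b⟩
    · simp only [edgeSchedule_none]
    · simp only [edgeSchedule_some] at h ⊢
      by_cases hv : D.dir a b ∧ v = b
      · simp only [if_pos hv]
        by_cases ha : a ∈ I
        · simp [ha]
        · by_cases ha' : a ∈ I'
          -- As `a` is not the head of the active edge, its outcome is coded by its own coin. The
          -- conditioning event says that this outcome is `x a`, so setting `a` to `x a` leaves the
          -- shift of `b` unchanged.
          · have hab : a ≠ b := by
              rintro rfl
              exact D.acyclic a (.single hv.1)
            have := h a ha'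
            rw [if_neg (fun h => hab h.2), Bool.xor_false] at this
            simp [ha, ha', ← this, hbit]
          · simp [ha, ha']
      · simp only [if_neg hv]
  · intro v I x
    refine ae_map_of_finite (Y := X v × X v) (T := T)
      (F := fun ω => (ω.outcome v I x, ω.outcome v (I ∩ D.parents v) x))
      (q := fun y => y.1 = y.2) hT
      ((measurable_outcome v I x).prodMk (measurable_outcome v _ x)) ?_
    rintro ⟨z, c⟩
    simp only [T]
    rcases z with _ | ⟨a, b⟩
    · simp only [edgeSchedule_none]
    · simp only [edgeSchedule_some]
      by_cases hv : D.dir a b ∧ v = b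
      · obtain ⟨hab, rfl⟩ := hv
        have : a ∈ I ∩ D.parents v ↔ a ∈ I := ⟨fun h => h.1, fun h => ⟨h, hab⟩⟩
        simp only [this]
      · simp only [if_neg hv]
  · intro x
    refine iIndepFun_map hT (fun v => measurable_outcome v _ x) ?_
    -- With all parents fixed by `x`, the shift reads the prescribed value of `a` and not its coin,
    -- so it depends on the active edge alone.
    let k : Option (V × V) → V → Bool := fun z v => z.elim false fun z =>
      if D.dir z.1 z.2 ∧ v = z.2 then decide (x z.1 = e z.1 true) else false
    have h := (iIndepFun_xor_coin κ k).comp (fun v => e v) fun v => measurable_of_finite _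
    convert h using 2 with v
    funext p
    obtain ⟨z, c⟩ := p
    simp only [T, Function.comp]
    rcases z with _ | ⟨a, b⟩
    · simp [edgeSchedule_none, k]
    · rw [edgeSchedule_some]
      by_cases hv : D.dir a b ∧ v = b
      · obtain ⟨hab, rfl⟩ := hv
        have : a ∈ D.parents v := hab
        simp [k, hab, this]
      · simp only [k, Option.elim, if_neg hv]
  · intro D' hD' a b hab
    by_contra hn
    -- On the atom where `a → b` is active and all coins are `false`, setting `a` to `e a true`
    -- changes the outcome of `b` from `e b false` to `e b true`. A DAG in which `a` is not a parent
    -- of `b` forbids this.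
    have h := hae _ (ae_of_ae_map hT.aemeasurable (hD'.2.1 b {a} fun v => e v true))
      (some (a, b), fun _ => false)
    have hemp : ({a} : Set V) ∩ D'.parents b = ∅ := by
      rw [Set.singleton_inter_eq_empty]
      exact hn
    rw [hemp] at h
    simp only [T, edgeSchedule_some] at h
    simp [hab] at h
    exact he b h.symm

end Witness

end CausalGraph

namespace CausalGraph

/-! ### Graphs determined by skeleton, directed edges or represented DAGs. -/

namespace PDAG

variable {V : Type*} {G D D' : PDAG V}

theorem skeleton_mono_of_dag (hD : D.IsDAG) (h : ∀ a b, D.dir a b → D'.dir a b) :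
    D.skeleton ≤ D'.skeleton := by
  rintro a b (hab | hab | hab)
  · exact Or.inl (h a b hab)
  · exact Or.inr (Or.inl (h b a hab))
  · rw [hD] at hab
    exact hab.elim

/-- The pair is adjacent in `D`, and the reverse direction there would give a 2-cycle in `D'`. Hence
inclusion between DAGs with the same skeleton is equality. -/
theorem IsDAG.dir_of_skeleton (hD : D.IsDAG) (hs : D'.skeleton ≤ D.skeleton)
    (h : ∀ a b, D.dir a b → D'.dir a b) {a b : V} (hab : D'.dir a b) : D.dir a b := by
  rcases hs (skeleton_of_dir hab) with h' | h' | h'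
  · exact h'
  · exact (not_dir_symm hab (h b a h')).elim
  · rw [hD] at h'
    exact h'.elim

theorem IsDAG.ext_of_skeleton (hD : D.IsDAG) (hD' : D'.IsDAG) (hs : D'.skeleton ≤ D.skeleton)
    (h : ∀ a b, D.dir a b → D'.dir a b) : D = D' := by
  ext a b
  · exact ⟨h a b, hD.dir_of_skeleton hs h⟩
  · rw [hD, hD']

theorem ext_of_skeleton_dir (hs : G.skeleton = D.skeleton) (h : ∀ a b, G.dir a b ↔ D.dir a b) :
    G = D := by
  have und_iff : ∀ (H : PDAG V) a b,
      H.und.Adj a b ↔ H.skeleton.Adj a b ∧ ¬ H.dir a b ∧ ¬ H.dir b a := fun H a b =>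
    ⟨fun hab => ⟨skeleton_of_und hab, fun h => H.not_both _ _ h hab,
      fun h => H.not_both _ _ h hab.symm⟩,
      fun ⟨h1, h2, h3⟩ => (h1.resolve_left h2).resolve_left h3⟩
  ext a b
  · exact h a b
  · rw [und_iff, und_iff, hs, h, h]

theorem represents_self (hD : D.IsDAG) : D.Represents D :=
  ⟨hD, rfl, fun _ _ => id, fun _ _ _ => id⟩

theorem IsDAG.represents_iff (hD : D.IsDAG) : D.Represents D' ↔ D' = D :=
  ⟨fun h => (hD.ext_of_skeleton h.1 h.2.1.le h.2.2.1).symm, by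
    rintro rfl
    exact represents_self hD⟩

theorem IsDAG.isMPDAG (hD : D.IsDAG) : D.IsMPDAG := by
  have hno : ∀ a b, ¬ D.und.Adj a b := fun a b h => by
    rw [hD] at h
    exact h.elim
  refine ⟨fun C => (chordal_induce_iff _).2 fun v c hc hs _ => ?_, fun a b c h => hno _ _ h.2.1,
    fun a b c h => hno _ _ h.2.2, fun a b c d h => hno _ _ h.1, fun a b c d h => hno _ _ h.1⟩
  cases c with
  | nil => exact absurd rfl hc.ne_nil
  | @cons _ w _ h p =>
    have hv : v ∈ C.supp := hs v (by simp)
    have hw : w ∈ C.supp := hs w (by simp)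
    have hvw : D.und.Reachable v w := SimpleGraph.ConnectedComponent.eq.1 (hv.trans hw.symm)
    rw [hD, SimpleGraph.reachable_bot] at hvw
    exact (h.ne hvw).elim

/-- A directed edge of an MPDAG is one that is present in all represented DAGs. -/
theorem IsMPDAG.dir_iff [Finite V] (hG : G.IsMPDAG) {a b : V} :
    G.dir a b ↔ ∀ D, G.Represents D → D.dir a b := by
  refine ⟨fun h D hD => hD.2.2.1 a b h, fun h => ?_⟩
  obtain ⟨D, hD⟩ := hG.exists_represents
  have hab : G.skeleton.Adj a b := hD.2.1 ▸ skeleton_of_dir (h D hD)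
  rcases hab with hab | hab | hab
  · exact hab
  · exact (not_dir_symm (h D hD) (hD.2.2.1 _ _ hab)).elim
  · obtain ⟨D', hD', hba⟩ := hG.exists_represents_dir hab.symm
    exact (not_dir_symm (h D' hD') hba).elim

/-- `G` without the directed edge `a → b`. -/
def deleteDir (G : PDAG V) (a b : V) : PDAG V where
  dir u v := G.dir u v ∧ ¬ (u = a ∧ v = b)
  und := G.und
  not_both u v h := G.not_both u v h.1
  acyclic v h := G.acyclic v (Relation.TransGen.mono (fun _ _ h => h.1) _ _ h)

theorem DeletesOneDirectedEdge.numDirected_eq [Finite V] (h : G.DeletesOneDirectedEdge D) :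
    G.numDirected = D.numDirected + 1 := by
  obtain ⟨a, b, hab, -, hdir⟩ := h
  unfold numDirected
  rw [← Set.ncard_sdiff_singleton_add_one (a := (a, b)) hab]
  congr 2
  ext ⟨u, v⟩
  simp [hdir]

theorem eq_empty_of_pseudoRank_eq_zero [Finite V] (h : G.pseudoRank = 0) : G = empty V := by
  unfold pseudoRank numDirected numUndirected at h
  have h1 : {e : V × V | G.dir e.1 e.2} = ∅ := (Set.ncard_eq_zero (Set.toFinite _)).1 (by omega)
  have h2 : G.und.edgeSet = ∅ := (Set.ncard_eq_zero (Set.toFinite _)).1 (by omega)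
  ext a b
  · refine ⟨fun hab => ?_, False.elim⟩
    have : (a, b) ∈ {e : V × V | G.dir e.1 e.2} := hab
    rw [h1] at this
    exact this.elim
  · rw [SimpleGraph.edgeSet_eq_empty.1 h2]
    rfl

end PDAG

/-! ### The order in graphical terms, and its covers. -/

section Order

variable {V : Type*} {X : V → Type*} [∀ v, MeasurableSpace (X v)]

/-- The model of a DAG grows with its set of edges. -/
theorem dagModel_mono {D D' : PDAG V} (h : ∀ a b, D.dir a b → D'.dir a b) :
    dagModel X D ⊆ dagModel X D' := by
  rintro P ⟨hP, hpa, hind⟩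
  have hsub : ∀ v, D.parents v ⊆ D'.parents v := fun v u hu => h u v hu
  refine ⟨hP, fun v I x => ?_, fun x => (hind x).congr fun v => ?_⟩
  · filter_upwards [hpa v I x, hpa v (I ∩ D'.parents v) x] with ω h1 h2
    rw [h1, h2, Set.inter_assoc, Set.inter_eq_right.2 (hsub v)]
  · filter_upwards [hpa v (D'.parents v) x] with ω h1
    rw [h1, Set.inter_eq_right.2 (hsub v)]

variable [Finite V] [∀ v, MeasurableSingletonClass (X v)] [∀ v, Nontrivial (X v)]

/-- Graphical description of the model-oriented order. -/
theorem modelLE_iff {G H : MPDAG V} : ModelLE X G H ↔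
    ∀ D, G.1.Represents D → ∃ D', H.1.Represents D' ∧ ∀ a b, D.dir a b → D'.dir a b := by
  constructor
  · intro h D hD
    obtain ⟨P, hP, hfaith⟩ := exists_faithful (X := X) D
    obtain ⟨D', hD', hP'⟩ := h ⟨D, hD, hP⟩
    exact ⟨D', hD', hfaith D' hP'⟩
  · rintro h P ⟨D, hD, hP⟩
    obtain ⟨D', hD', hle⟩ := h D hD
    exact ⟨D', hD', dagModel_mono hle hP⟩

/-- Between MPDAGs with the same skeleton the order is inclusion of the represented DAGs. -/
theorem ModelLE.represents {G H : MPDAG V} (h : ModelLE X G H)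
    (hs : H.1.skeleton = G.1.skeleton) {D : PDAG V} (hD : G.1.Represents D) :
    H.1.Represents D := by
  obtain ⟨D', hD', hle⟩ := modelLE_iff.1 h D hD
  have : D = D' := hD.1.ext_of_skeleton hD'.1 (by rw [hD'.2.1, hs, hD.2.1]) hle
  exact this ▸ hD'

theorem ModelLE.skeleton_le {G H : MPDAG V} (h : ModelLE X G H) :
    G.1.skeleton ≤ H.1.skeleton := by
  obtain ⟨D, hD⟩ := G.2.exists_represents
  obtain ⟨D', hD', hle⟩ := modelLE_iff.1 h D hD
  rw [← hD.2.1, ← hD'.2.1]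
  exact PDAG.skeleton_mono_of_dag hD.1 hle

theorem ModelLE.dir {G H : MPDAG V} (h : ModelLE X G H) (hs : H.1.skeleton = G.1.skeleton)
    {a b : V} (hab : H.1.dir a b) : G.1.dir a b :=
  G.2.dir_iff.2 fun D hD => H.2.dir_iff.1 hab D (h.represents hs hD)

/-- An intermediate `K` has the common skeleton, so its directed edges lie between those of `G` and
those of `H`, which differ only by `a → b`. Skeleton and directed edges determine the graph. -/
theorem coveredBy_of_orientsOneEdge {G H : MPDAG V} (h : G.1.OrientsOneEdge H.1) :
    CoveredBy X H G := by
  refine ⟨⟨modelLE_iff.2 fun D hD => ⟨D, h.represents G.2.2.1 hD, fun _ _ => id⟩, ?_⟩, ?_⟩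
  · rintro rfl
    exact absurd h.numUndirected_eq (by omega)
  · rintro ⟨K, ⟨hHK, hHK'⟩, ⟨hKG, hKG'⟩⟩
    have hs := h.skeleton_eq
    have hsK : K.1.skeleton = G.1.skeleton :=
      le_antisymm hKG.skeleton_le (hs.symm.le.trans hHK.skeleton_le)
    obtain ⟨a, b, -, -, hdir⟩ := h
    have h1 : ∀ u v, G.1.dir u v → K.1.dir u v := fun u v => hKG.dir hsK.symm
    have h2 : ∀ u v, K.1.dir u v → H.1.dir u v := fun u v => hHK.dir (hsK.trans hs.symm)
    by_cases hab : K.1.dir a b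
    · refine hHK' (Subtype.ext (PDAG.ext_of_skeleton_dir (hs.trans hsK.symm) fun u v => ?_))
      refine ⟨fun huv => ?_, h2 u v⟩
      rcases (hdir u v).1 huv with huv | ⟨rfl, rfl⟩
      · exact h1 u v huv
      · exact hab
    · refine hKG' (Subtype.ext (PDAG.ext_of_skeleton_dir hsK fun u v => ⟨fun huv => ?_, h1 u v⟩))
      rcases (hdir u v).1 (h2 u v huv) with huv' | ⟨rfl, rfl⟩
      · exact huv'
      · exact (hab huv).elim

/-- An intermediate `K` represents only subgraphs of the DAG `G`. An undirected edge of `K` would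
occur in both orientations, putting a 2-cycle into `G`; so `K` is a DAG between `H` and `G`. -/
theorem coveredBy_of_deletesOneDirectedEdge {G H : MPDAG V} (hG : G.1.IsDAG)
    (h : G.1.DeletesOneDirectedEdge H.1) : CoveredBy X H G := by
  have hnum := h.numDirected_eq
  obtain ⟨a, b, hab, hund, hdir⟩ := h
  have hH : H.1.IsDAG := hund.trans hG
  refine ⟨⟨modelLE_iff.2 fun D hD => ⟨G.1, PDAG.represents_self hG, fun u v huv => ?_⟩, ?_⟩, ?_⟩
  · rw [hH.represents_iff.1 hD] at huv
    exact ((hdir u v).1 huv).1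
  · rintro rfl
    omega
  · rintro ⟨K, ⟨hHK, hHK'⟩, ⟨hKG, hKG'⟩⟩
    have hle : ∀ D, K.1.Represents D → ∀ u v, D.dir u v → G.1.dir u v := by
      intro D hD
      obtain ⟨D', hD', h'⟩ := modelLE_iff.1 hKG D hD
      rwa [hG.represents_iff.1 hD'] at h'
    have hK : K.1.IsDAG := by
      by_contra hne
      obtain ⟨u, v, huv⟩ := SimpleGraph.ne_bot_iff_exists_adj.1 hne
      obtain ⟨D, hD, hDuv⟩ := K.2.exists_represents_dir huv
      obtain ⟨D', hD', hDvu⟩ := K.2.exists_represents_dir huv.symm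
      exact PDAG.not_dir_symm (hle D hD u v hDuv) (hle D' hD' v u hDvu)
    have h1 : ∀ u v, H.1.dir u v → K.1.dir u v := by
      obtain ⟨D', hD', h'⟩ := modelLE_iff.1 hHK H.1 (PDAG.represents_self hH)
      rwa [hK.represents_iff.1 hD'] at h'
    have h2 := hle K.1 (PDAG.represents_self hK)
    by_cases hKab : K.1.dir a b
    · refine hKG' (Subtype.ext (PDAG.ext (funext₂ fun u v => propext ⟨h2 u v, fun huv => ?_⟩)
        (hK.trans hG.symm)))
      by_cases he : u = a ∧ v = b
      · obtain ⟨rfl, rfl⟩ := he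
        exact hKab
      · exact h1 u v ((hdir u v).2 ⟨huv, he⟩)
    · refine hHK' (Subtype.ext (PDAG.ext (funext₂ fun u v => propext ⟨h1 u v, fun huv => ?_⟩)
        (hH.trans hK.symm)))
      refine (hdir u v).2 ⟨h2 u v huv, ?_⟩
      rintro ⟨rfl, rfl⟩
      exact hKab huv

variable (X) in
/-- Every nonempty MPDAG covers one obtained by orienting an undirected edge or, for a DAG, by
deleting an edge. -/
theorem exists_coveredBy (G : MPDAG V) {n : ℕ} (hn : G.1.pseudoRank = n + 1) :
    ∃ H : MPDAG V, H.1.pseudoRank = n ∧ H.1.numUndirected = G.1.numUndirected - 1 ∧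
      CoveredBy X H G ∧ (0 < G.1.numUndirected → G.1.OrientsOneEdge H.1) ∧
      (G.1.numUndirected = 0 → G.1.DeletesOneDirectedEdge H.1) := by
  by_cases hG : G.1.und = ⊥
  · have h0 : G.1.numUndirected = 0 := by simp [PDAG.numUndirected, hG]
    have hpos : G.1.numDirected ≠ 0 := by
      unfold PDAG.pseudoRank at hn
      omega
    obtain ⟨⟨a, b⟩, hab⟩ := Set.nonempty_of_ncard_ne_zero hpos
    have hdag : (G.1.deleteDir a b).IsDAG := hG
    have hdel : G.1.DeletesOneDirectedEdge (G.1.deleteDir a b) :=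
      ⟨a, b, hab, rfl, fun _ _ => Iff.rfl⟩
    have hnum := hdel.numDirected_eq
    have h0' : (G.1.deleteDir a b).numUndirected = 0 := h0
    -- Truncated subtraction, `0 - 1 = 0`, lets one formula for the number of undirected edges serve
    -- both kinds of step.
    refine ⟨⟨_, hdag.isMPDAG⟩, ?_, by rw [h0', h0],
      coveredBy_of_deletesOneDirectedEdge hG hdel, fun h => by omega, fun _ => hdel⟩
    unfold PDAG.pseudoRank at hn ⊢
    dsimp only
    omega
  · obtain ⟨a, b, hab⟩ := SimpleGraph.ne_bot_iff_exists_adj.1 hG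
    obtain ⟨H, hH, y, x, -, hor⟩ := G.2.exists_orient hab
    have hor' : G.1.OrientsOneEdge H := ⟨y, x, hor⟩
    have h1 := hor'.numUndirected_eq
    have h2 := hor'.numDirected_eq
    refine ⟨⟨H, hH⟩, ?_, by dsimp only; omega, coveredBy_of_orientsOneEdge hor', fun _ => hor',
      fun h => by omega⟩
    unfold PDAG.pseudoRank at hn ⊢
    dsimp only
    omega

variable (X) in
theorem exists_covering_chain (n : ℕ) (G : MPDAG V) (hn : G.1.pseudoRank = n) :
    ∃ x : Fin (n + 1) → MPDAG V, x 0 = G ∧ x (Fin.last n) = MPDAG.empty V ∧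
      ∀ i : Fin n, CoveredBy X (x i.succ) (x i.castSucc) ∧
        ((i : ℕ) < G.1.numUndirected → (x i.castSucc).1.OrientsOneEdge (x i.succ).1) ∧
        (G.1.numUndirected ≤ (i : ℕ) → (x i.castSucc).1.DeletesOneDirectedEdge (x i.succ).1) := by
  induction n generalizing G with
  | zero =>
    exact ⟨fun _ => G, rfl, Subtype.ext (PDAG.eq_empty_of_pseudoRank_eq_zero hn),
      fun i => i.elim0⟩
  | succ n ih =>
    obtain ⟨H, hH, hund, hcov, hor, hdel⟩ := exists_coveredBy X G hn
    obtain ⟨x, hx0, hxlast, hx⟩ := ih H hH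
    refine ⟨Fin.cons G x, rfl, ?_, fun i => ?_⟩
    · rw [← Fin.succ_last, Fin.cons_succ, hxlast]
    · refine Fin.cases ?_ (fun i => ?_) i
      · rw [Fin.castSucc_zero, Fin.cons_zero, Fin.cons_succ, hx0]
        exact ⟨hcov, fun h => hor h, fun h => hdel (Nat.le_zero.1 h)⟩
      -- The chain of `H` is shifted by one place, and the threshold between the two kinds of step
      -- moves with it.
      · rw [Fin.castSucc_succ, Fin.cons_succ, Fin.cons_succ, Fin.val_succ]
        obtain ⟨h1, h2, h3⟩ := hx i
        exact ⟨h1, fun h => h2 (by omega), fun h => h3 (by omega)⟩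

end Order

end CausalGraph

theorem proposition4p11 {V : Type*} [Finite V] (X : V → Type*) [∀ v, MeasurableSpace (X v)]
    [∀ v, MeasurableSingletonClass (X v)] [∀ v, Nontrivial (X v)] (G : CausalGraph.MPDAG V) :
    ∃ x : Fin (G.1.pseudoRank + 1) → CausalGraph.MPDAG V,
      x 0 = G ∧ x (Fin.last G.1.pseudoRank) = CausalGraph.MPDAG.empty V ∧
      ∀ i : Fin G.1.pseudoRank,
        CausalGraph.CoveredBy X (x i.succ) (x i.castSucc) ∧
        ((i : ℕ) < G.1.numUndirected → (x i.castSucc).1.OrientsOneEdge (x i.succ).1) ∧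
        (G.1.numUndirected ≤ (i : ℕ) → (x i.castSucc).1.DeletesOneDirectedEdge (x i.succ).1) :=
  CausalGraph.exists_covering_chain X _ G rfl
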